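/- Let $G$ be a finite graph (loops and parallel edges allowed) drawn on the torus $\mathbb T=\mathbb R^2/\mathbb Z^2$. Each edge is regarded as a pair of opposite darts $d$ and $\mathrm{rev}(d)$, and each dart $d$ carries a translation vector $\tau_d\in\mathbb Z^2$ determined by the drawing, with $\tau_{\mathrm{rev}(d)}=-\tau_d$; thus a dart $d$ from $u$ to $v$ lifts to arcs from $(u,z)$ to $(v,z+\tau_d)$, $z\in\mathbb Z^2$, in the universal cover of the drawing, which is an infinite, doubly periodic plane graph. Assume that the drawing is essentially $3$-connected, that is, its universal cover is $3$-connected: it has no loops, and it stays connected after the removal of any set of at most two vertices (parallel edges in the universal cover are permitted). A weight vector $\lambda=(\lambda_d)_d$ of positive real numbers, one for every dart, is called realizable for $G$ if the linear system $$\sum_{v}\ \sum_{d\colon u\to v}\lambda_d\,(p_v-p_u+\tau_d)=(0,0)\qquad\text{for every vertex }u$$ has a solution $p_v\in\mathbb R^2$ ($v\in V(G)$). Fix any dart $d$ of $G$, and let $\lambda$ be the (positive) weight vector with $\lambda_d=2$ and $\lambda_{d'}=1$ for every dart $d'\neq d$. Then $\lambda$ is not realizable for $G$. -/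

import Mathlib

/-- A graph, possibly with loops and parallel edges, given by its darts: every edge is a pair of
opposite darts, `tail d` is the vertex that `d` leaves, and `rev d` is the reversal of `d`. -/
structure DartGraph (V D : Type*) where
  tail : D → V
  rev : Equiv.Perm D
  rev_rev : ∀ d, rev (rev d) = d
  rev_ne : ∀ d, rev d ≠ d

namespace DartGraph

variable {V D : Type*}

/-- The head of a dart. -/
def head (G : DartGraph V D) (d : D) : V := G.tail (G.rev d)

end DartGraph

/-- A graph with a rotation system: `rot` permutes cyclically the darts that leave each vertex.
This is the standard description of a drawing of the graph on an oriented surface all of whose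
faces are disks, up to homeomorphism. -/
structure RotationGraph (V D : Type*) extends DartGraph V D where
  rot : Equiv.Perm D
  sameCycle_rot_iff : ∀ d e, rot.SameCycle d e ↔ tail d = tail e

namespace RotationGraph

variable {V D : Type*}

/-- The face permutation: the dart that follows `d` on the boundary of the face beside `d`. -/
def facePerm (G : RotationGraph V D) : Equiv.Perm D := G.rev.trans G.rot

/-- The faces of the drawing: the cycles (fixed points included) of the face permutation. -/
def Face (G : RotationGraph V D) : Type _ :=
  Quotient (Equiv.Perm.SameCycle.setoid G.facePerm)

end RotationGraph

/-- A finite graph drawn on the torus `ℝ² / ℤ²`, together with the translation vectors of its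
darts. The drawing is described by a rotation system of Euler characteristic `0`. The translation
vectors are antisymmetric and sum to zero around every face, that is, they come from a homomorphism
from the fundamental group of the surface to `ℤ²`. This homomorphism is onto, hence an isomorphism,
and the surface is connected, hence a torus, as soon as the graph `G.cover` below is connected;
that is part of `G.EssentiallyThreeConnected`. -/
structure TorusGraph (V D : Type*) [Fintype V] [Fintype D] extends RotationGraph V D where
  /-- `|V| - |E| + |F| = 0`, where `2 |E| = |D|`. -/
  euler : 2 * (Fintype.card V + Nat.card toRotationGraph.Face) = Fintype.card D
  transl : D → Fin 2 → ℤ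
  transl_rev : ∀ d, transl (rev d) = -transl d
  transl_face : ∀ d, ∑ᶠ e ∈ {e | toRotationGraph.facePerm.SameCycle d e}, transl e = 0

namespace TorusGraph

variable {V D : Type*} [Fintype V] [Fintype D]

/-- The simple graph underlying the universal cover of the drawing, with vertex set `V × ℤ²`: each
dart `d` from `u` to `v` lifts to the darts from `(u, z)` to `(v, z + transl d)`, for `z` in `ℤ²`.
Multiplicities of edges are forgotten, since connectivity does not depend on them. -/
def cover (G : TorusGraph V D) : SimpleGraph (V × (Fin 2 → ℤ)) where
  Adj x y := x ≠ y ∧ ∃ d, G.tail d = x.1 ∧ G.head d = y.1 ∧ y.2 = x.2 + G.transl d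
  symm := by
    constructor
    rintro x y ⟨hne, d, h1, h2, h3⟩
    refine ⟨hne.symm, G.rev d, h2, ?_, ?_⟩
    · simpa [DartGraph.head, G.rev_rev] using h1
    · rw [G.transl_rev, h3]; abel
  loopless := by
    constructor
    rintro x ⟨h, _⟩
    exact h rfl

/-- The universal cover of the drawing is 3-connected: it has no loops, and it remains connected
after the removal of any set of at most two vertices. (It is infinite, and parallel edges in it are
not excluded.) -/
def EssentiallyThreeConnected (G : TorusGraph V D) : Prop :=
  (∀ d, G.tail d = G.head d → G.transl d ≠ 0) ∧
    ∀ S : Finset (V × (Fin 2 → ℤ)), S.card ≤ 2 →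
      (G.cover.induce ((S : Set (V × (Fin 2 → ℤ)))ᶜ)).Connected

/-- The vertex positions `p` solve the barycentric linear system with dart weights `w`:
at every vertex `u`, the sum of `w d • (p v - p u + transl d)` over all darts `d : u → v` is `0`. -/
def IsBarycentric (G : TorusGraph V D) (w : D → ℝ) (p : V → Fin 2 → ℝ) : Prop :=
  ∀ u : V, ∑ᶠ d ∈ {d | G.tail d = u},
    w d • (p (G.head d) - p u + fun i => (G.transl d i : ℝ)) = 0

/-- A (positive) weight vector is realizable for `G` if its barycentric linear system is
solvable. -/
def Realizable (G : TorusGraph V D) (w : D → ℝ) : Prop :=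
  ∃ p : V → Fin 2 → ℝ, G.IsBarycentric w p

end TorusGraph

/-!
The displacements `p (head d) - p (tail d) + transl d` of a solution `p` are antisymmetric under
reversal of darts. In the sum of the equations of all vertices, opposite darts of weight `1` cancel,
so what remains is the displacement of the dart of weight `2`. It is therefore `0`, and `p` also
solves the system in which all weights are `1`: the drawing is in equilibrium, and one of its edges
is contracted to a point. `EssentiallyThreeConnected.displ_ne_zero` shows that this is impossible.

The tool is an index count. Let `ω` be a component of the displacement in some direction; it sums to
zero at each vertex and around each face. If the darts are given signs, opposite for opposite darts,
then each corner carries exactly one sign change, either at its vertex or along its face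
(`RotationGraph.sum_card_signChanges`). By the Euler formula there are `2 (|V| + |F|)` corners, so
if all vertices and faces see both signs, hence at least two changes, then all see exactly two. The
signs are those of `ω`, with zeros broken by a second function `β` that takes both signs wherever
`ω` vanishes identically; comparing `β` with `-β` shows that at other vertices and faces the sign of
`β` is constant on each run of zeros of `ω` (`IsTieBroken.pos_iff_pos_rot` and
`IsTieBroken.pos_iff_pos_facePerm`).

Suppose `ω` vanishes at all darts of a vertex. Consider the component of this vertex in the graph of
the zeros of `ω`, where a run of zeros at a vertex at which `ω` is not identically zero is a node of
its own. Counting corners shows that its Euler characteristic, with the faces on which `ω` vanishes,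
is half its number of runs (`IsZeroComponent.card_eq`). Unless the component is everything, it is
at most `1`, because differences of node functions and boundaries of faces are orthogonal and,
up to constants, injective in their data. So there are two runs, and the characteristic is `1`; then
dimensions agree, the translation vectors are differences of a node function, and the component
lifts to the universal cover, where it is attached to the rest at no more than two vertices
(`IsZeroComponent.card_runEnds_le_two_and_exact`). This contradicts 3-connectivity
(`EssentiallyThreeConnected.exists_dart_dotProduct_ne_zero`).

It remains to find such an `ω` if a dart has displacement zero. If all darts at its tail do, any
direction will do. Otherwise there is a corner between a zero and a nonzero displacement `b`, and
`ω` is the component perpendicular to `b`. It is zero on both sides of the corner. Breaking ties by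
the component along `b` or along `-b` changes the sign of one side only, so the sign cannot be
constant on this run, and `ω` vanishes identically at the vertex.

The function `β` is the component in a second direction. Its own ties are broken by the differences
of an injective function of the vertices, without local extrema at those vertices all of whose darts
have displacement zero. It is built from ears, which exist because no single vertex separates the
universal cover (`EssentiallyThreeConnected.exists_noLocalExtremum`).
-/

section
open scoped Classical

/-! ### Sign changes along the cycles of a permutation -/

/-- The real function `f` takes a positive and a negative value on `s`. -/
def TakesBothSigns {D : Type*} (f : D → ℝ) (s : Set D) : Prop :=
  (∃ x ∈ s, 0 < f x) ∧ ∃ x ∈ s, f x < 0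

theorem TakesBothSigns.neg {D : Type*} {f : D → ℝ} {s : Set D} (h : TakesBothSigns f s) :
    TakesBothSigns (-f) s := by
  obtain ⟨⟨x, hx, h1⟩, y, hy, h2⟩ := h
  exact ⟨⟨y, hy, by simpa using h2⟩, x, hx, by simpa using h1⟩

theorem takesBothSigns_of_sum_eq_zero {D : Type*} [Fintype D] {f : D → ℝ} {s : Set D}
    (h : ∑ d with d ∈ s, f d = 0) {x : D} (hx : x ∈ s) (hfx : f x ≠ 0) :
    TakesBothSigns f s := by
  constructor
  · obtain ⟨y, hy, hpos⟩ := Finset.exists_pos_of_sum_zero_of_exists_nonzero f h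
      ⟨x, by simpa using hx, hfx⟩
    exact ⟨y, by simpa using hy, hpos⟩
  · obtain ⟨y, hy, hpos⟩ := Finset.exists_pos_of_sum_zero_of_exists_nonzero (fun d => - f d)
      (by rw [Finset.sum_neg_distrib, h, neg_zero]) ⟨x, by simpa using hx, by simpa using hfx⟩
    exact ⟨y, by simpa using hy, by simpa using hpos⟩

section Cycles

variable {D K : Type*} [Fintype D]

/-- The darts of the class `k` of `κ` at which the truth value of `P` changes under `r`. In the
applications the classes of `κ` are the cycles of `r`. -/
noncomputable def signChanges (r : Equiv.Perm D) (κ : D → K) (P : D → Prop) (k : K) : Finset D :=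
  {x | κ x = k ∧ ¬(P x ↔ P (r x))}

theorem exists_change_of_sameCycle {r : Equiv.Perm D} {P : D → Prop} {d e : D}
    (h : r.SameCycle d e) (hd : P d) (he : ¬P e) : ∃ x, r.SameCycle d x ∧ P x ∧ ¬P (r x) := by
  by_contra hcon
  push Not at hcon
  obtain ⟨n, hn⟩ := h.exists_nat_pow_eq
  have key : ∀ m : ℕ, P ((r ^ m) d) := by
    intro m
    induction m with
    | zero => simpa using hd
    | succ m ih =>
      rw [pow_succ', Equiv.Perm.mul_apply]
      exact hcon _ ⟨m, by simp⟩ ih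
  exact he (hn ▸ key n)

theorem two_le_card_signChanges {r : Equiv.Perm D} {κ : D → K}
    (hκ : ∀ d e, r.SameCycle d e ↔ κ d = κ e) {P : D → Prop} {k : K}
    (h1 : ∃ x, κ x = k ∧ P x) (h2 : ∃ x, κ x = k ∧ ¬P x) :
    2 ≤ (signChanges r κ P k).card := by
  obtain ⟨x, hx, hPx⟩ := h1
  obtain ⟨y, hy, hPy⟩ := h2
  have hxy : r.SameCycle x y := (hκ x y).2 (hx.trans hy.symm)
  obtain ⟨z, hz, hz1, hz2⟩ := exists_change_of_sameCycle hxy hPx hPy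
  obtain ⟨t, ht, ht1, ht2⟩ := exists_change_of_sameCycle (P := fun d => ¬P d) hxy.symm hPy
    (not_not.2 hPx)
  have hzk : κ z = k := ((hκ x z).1 hz).symm.trans hx
  have htk : κ t = k := ((hκ y t).1 ht).symm.trans hy
  have hne : z ≠ t := fun h => ht1 (h ▸ hz1)
  rw [← Finset.card_pair hne]
  apply Finset.card_le_card
  intro a ha
  simp only [Finset.mem_insert, Finset.mem_singleton] at ha
  simp only [signChanges, Finset.mem_filter, Finset.mem_univ, true_and]
  rcases ha with rfl | rfl
  · exact ⟨hzk, by tauto⟩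
  · exact ⟨htk, by tauto⟩

/-- The dart is positive for `ω`, where ties are broken by `β`. -/
def LexPos (ω β : D → ℝ) (d : D) : Prop := 0 < ω d ∨ (ω d = 0 ∧ 0 < β d)

/-- If `ω` takes both signs on a cycle of `r`, and both ways of breaking ties by `β` and `-β`
produce exactly two sign changes, then `β` has a constant sign along each run of zeros of `ω`.
The two ways of breaking ties are compared with those that make all zeros positive, respectively
negative, which also produce two sign changes at least. -/
theorem pos_iff_pos_of_card_signChanges_eq_two {r : Equiv.Perm D} {κ : D → K}
    (hκ : ∀ d e, r.SameCycle d e ↔ κ d = κ e) {ω β : D → ℝ} {k : K}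
    (hβ : ∀ d, ω d = 0 → β d ≠ 0) (hω : TakesBothSigns ω {x | κ x = k})
    (h1 : (signChanges r κ (LexPos ω β) k).card = 2)
    (h2 : (signChanges r κ (LexPos ω (-β)) k).card = 2)
    {x : D} (hx : κ x = k) (h0 : ω x = 0) (h0' : ω (r x) = 0) : 0 < β x ↔ 0 < β (r x) := by
  obtain ⟨⟨y, hy, hypos⟩, z, hz, hzneg⟩ := hω
  have h3 := two_le_card_signChanges hκ (P := fun d => 0 ≤ ω d) (k := k)
    ⟨y, hy, hypos.le⟩ ⟨z, hz, not_le.2 hzneg⟩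
  have h4 := two_le_card_signChanges hκ (P := fun d => 0 < ω d) (k := k)
    ⟨y, hy, hypos⟩ ⟨z, hz, not_lt.2 hzneg.le⟩
  have key : (signChanges r κ (LexPos ω β) k).card + (signChanges r κ (LexPos ω (-β)) k).card =
      (signChanges r κ (fun d => 0 ≤ ω d) k).card + (signChanges r κ (fun d => 0 < ω d) k).card +
      2 * (Finset.univ.filter fun d => κ d = k ∧ ω d = 0 ∧ ω (r d) = 0 ∧
        ¬(0 < β d ↔ 0 < β (r d))).card := by
    simp only [signChanges, Finset.card_filter, Finset.mul_sum, ← Finset.sum_add_distrib]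
    refine Finset.sum_congr rfl fun d _ => ?_
    by_cases hd : κ d = k
    swap
    · simp [hd]
    have e1 := hβ d
    have e2 := hβ (r d)
    simp only [LexPos, hd, true_and, Pi.neg_apply]
    rcases lt_trichotomy (ω d) 0 with a | a | a <;>
    rcases lt_trichotomy (ω (r d)) 0 with b | b | b
    · simp [a.ne, a.not_gt, a.not_ge, b.ne, b.not_gt, b.not_ge]
    · rcases lt_or_gt_of_ne (e2 b) with c | c <;>
      simp [a.ne, a.not_gt, a.not_ge, b, c, c.not_gt]
    · simp [a.ne, a.not_gt, a.not_ge, b, b.le]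
    · rcases lt_or_gt_of_ne (e1 a) with c | c <;>
      simp [a, b.ne, b.not_gt, b.not_ge, c, c.not_gt]
    · rcases lt_or_gt_of_ne (e1 a) with c | c <;> rcases lt_or_gt_of_ne (e2 b) with c' | c' <;>
      simp [a, b, c, c.not_gt, c', c'.not_gt]
    · rcases lt_or_gt_of_ne (e1 a) with c | c <;>
      simp [a, b.le, b.ne', b, c, c.not_gt]
    · simp [a, a.le, b.ne, b.not_gt, b.not_ge]
    · rcases lt_or_gt_of_ne (e2 b) with c | c <;>
      simp [a, a.le, a.ne', b, c, c.not_gt]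
    · simp [a, a.le, a.ne', b, b.le]
  have h5 : (Finset.univ.filter fun d => κ d = k ∧ ω d = 0 ∧ ω (r d) = 0 ∧
        ¬(0 < β d ↔ 0 < β (r d))).card = 0 := by omega
  by_contra hcon
  rw [Finset.card_eq_zero] at h5
  have : x ∈ (∅ : Finset D) := by
    rw [← h5]; simp only [Finset.mem_filter, Finset.mem_univ, true_and]
    exact ⟨hx, h0, h0', hcon⟩
  simp at this

end Cycles

/-! ### The index formula -/

namespace RotationGraph

variable {V D : Type*} (G : RotationGraph V D)

/-- The face beside a dart. -/
def faceOf (d : D) : G.Face := Quotient.mk _ d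

theorem sameCycle_facePerm_iff (d e : D) :
    G.facePerm.SameCycle d e ↔ G.faceOf d = G.faceOf e := by
  exact (Quotient.eq (r := Equiv.Perm.SameCycle.setoid G.facePerm)).symm

theorem faceOf_surjective (f : G.Face) : ∃ d, G.faceOf d = f := Quotient.exists_rep f

instance [Finite D] : Finite G.Face := Finite.of_surjective G.faceOf G.faceOf_surjective

noncomputable instance [Finite D] : Fintype G.Face := Fintype.ofFinite _

theorem facePerm_apply (d : D) : G.facePerm d = G.rot (G.rev d) := rfl

@[simp] theorem faceOf_facePerm (d : D) : G.faceOf (G.facePerm d) = G.faceOf d :=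
  (G.sameCycle_facePerm_iff _ _).1 (Equiv.Perm.sameCycle_apply_left.2 (.refl _ _))

@[simp] theorem tail_rot (d : D) : G.tail (G.rot d) = G.tail d :=
  (G.sameCycle_rot_iff _ _).1 (Equiv.Perm.sameCycle_apply_left.2 (.refl _ _))

theorem tail_facePerm (d : D) : G.tail (G.facePerm d) = G.head d := by
  rw [facePerm_apply, tail_rot]; rfl

/-- A dart function `ω` together with a way `β` of breaking its ties: both are antisymmetric, `β`
does not vanish where `ω` does, and at each vertex and along each face `ω` takes both signs, or
vanishes identically and `β` takes both signs. -/
structure IsTieBroken (ω β : D → ℝ) : Prop where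
  rev_left : ∀ d, ω (G.rev d) = -ω d
  rev_right : ∀ d, β (G.rev d) = -β d
  ne_zero : ∀ d, ω d = 0 → β d ≠ 0
  vertex : ∀ v, TakesBothSigns ω {d | G.tail d = v} ∨
    (∀ d, G.tail d = v → ω d = 0) ∧ TakesBothSigns β {d | G.tail d = v}
  face : ∀ f, TakesBothSigns ω {d | G.faceOf d = f} ∨
    (∀ d, G.faceOf d = f → ω d = 0) ∧ TakesBothSigns β {d | G.faceOf d = f}

namespace IsTieBroken

variable {G} {ω β : D → ℝ}

theorem neg_right (h : G.IsTieBroken ω β) : G.IsTieBroken ω (-β) where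
  rev_left := h.rev_left
  rev_right d := by simp [h.rev_right]
  ne_zero d hd := by simpa using h.ne_zero d hd
  vertex v := (h.vertex v).imp_right fun h => ⟨h.1, h.2.neg⟩
  face v := (h.face v).imp_right fun h => ⟨h.1, h.2.neg⟩

theorem lexPos_rev (h : G.IsTieBroken ω β) (d : D) :
    LexPos ω β (G.rev d) ↔ ¬LexPos ω β d := by
  have := h.ne_zero d
  simp only [LexPos, h.rev_left, h.rev_right]
  rcases lt_trichotomy (ω d) 0 with a | a | a
  · simp [a, a.not_gt, a.ne]
  · rcases lt_or_gt_of_ne (this a) with c | c <;> simp [a, c, c.not_gt]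
  · simp [a, a.not_gt, a.ne']

end IsTieBroken

variable [Fintype V] [Fintype D]

/-- Every corner carries exactly one sign change: either at its vertex or along its face. -/
theorem sum_card_signChanges {P : D → Prop} (hP : ∀ d, P (G.rev d) ↔ ¬P d) :
    ∑ v, (signChanges G.rot G.tail P v).card + ∑ f, (signChanges G.facePerm G.faceOf P f).card =
      Fintype.card D := by
  have h1 : ∑ v, (signChanges G.rot G.tail P v).card =
      (Finset.univ.filter fun d => ¬(P d ↔ P (G.rot d))).card := by
    rw [Finset.card_eq_sum_card_fiberwise (f := G.tail) (t := Finset.univ) (by simp)]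
    refine Finset.sum_congr rfl fun v _ => congrArg _ ?_
    ext d; simp [signChanges, and_comm]
  have h2 : ∑ f, (signChanges G.facePerm G.faceOf P f).card =
      (Finset.univ.filter fun d => (P d ↔ P (G.rot d))).card := by
    have : ∑ f, (signChanges G.facePerm G.faceOf P f).card =
        (Finset.univ.filter fun d => ¬(P d ↔ P (G.facePerm d))).card := by
      rw [Finset.card_eq_sum_card_fiberwise (f := G.faceOf) (t := Finset.univ) (by simp)]
      refine Finset.sum_congr rfl fun v _ => congrArg _ ?_
      ext d; simp [signChanges, and_comm]
    rw [this]
    refine Finset.card_equiv G.rev fun d => ?_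
    rw [Finset.mem_filter, Finset.mem_filter, facePerm_apply, hP d]
    simp only [Finset.mem_univ, true_and]
    tauto
  rw [h1, h2, add_comm, Finset.card_filter_add_card_filter_not, Finset.card_univ]

/-- On a surface of Euler characteristic `0`, if every vertex and every face carries both signs,
then every vertex and every face carries exactly two sign changes. -/
theorem card_signChanges_eq_two
    (euler : 2 * (Fintype.card V + Nat.card G.Face) = Fintype.card D)
    {P : D → Prop} (hP : ∀ d, P (G.rev d) ↔ ¬P d)
    (hv : ∀ v, (∃ d, G.tail d = v ∧ P d) ∧ ∃ d, G.tail d = v ∧ ¬P d)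
    (hf : ∀ f, (∃ d, G.faceOf d = f ∧ P d) ∧ ∃ d, G.faceOf d = f ∧ ¬P d) :
    (∀ v, (signChanges G.rot G.tail P v).card = 2) ∧
      ∀ f, (signChanges G.facePerm G.faceOf P f).card = 2 := by
  have key := G.sum_card_signChanges hP
  have h1 : ∀ v ∈ Finset.univ, 2 ≤ (signChanges G.rot G.tail P v).card := fun v _ =>
    two_le_card_signChanges G.sameCycle_rot_iff (hv v).1 (hv v).2
  have h2 : ∀ f ∈ Finset.univ, 2 ≤ (signChanges G.facePerm G.faceOf P f).card := fun f _ =>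
    two_le_card_signChanges G.sameCycle_facePerm_iff (hf f).1 (hf f).2
  have s1 := Finset.sum_le_sum h1
  have s2 := Finset.sum_le_sum h2
  have e1 : ∑ _v : V, 2 = 2 * Fintype.card V := by simp [mul_comm]
  have e2 : ∑ _f : G.Face, 2 = 2 * Nat.card G.Face := by
    simp [mul_comm, Nat.card_eq_fintype_card]
  constructor
  · have := (Finset.sum_eq_sum_iff_of_le h1).1 (by omega)
    exact fun v => (this v (Finset.mem_univ v)).symm
  · have := (Finset.sum_eq_sum_iff_of_le h2).1 (by omega)
    exact fun v => (this v (Finset.mem_univ v)).symm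

namespace IsTieBroken

variable {G} {ω β : D → ℝ}

theorem card_signChanges (h : G.IsTieBroken ω β)
    (euler : 2 * (Fintype.card V + Nat.card G.Face) = Fintype.card D) :
    (∀ v, (signChanges G.rot G.tail (LexPos ω β) v).card = 2) ∧
      ∀ f, (signChanges G.facePerm G.faceOf (LexPos ω β) f).card = 2 := by
  have aux : ∀ s : Set D, (TakesBothSigns ω s ∨ (∀ d ∈ s, ω d = 0) ∧ TakesBothSigns β s) →
      (∃ d, d ∈ s ∧ LexPos ω β d) ∧ ∃ d, d ∈ s ∧ ¬LexPos ω β d := by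
    rintro s (⟨⟨x, hx, hx'⟩, y, hy, hy'⟩ | ⟨h0, ⟨x, hx, hx'⟩, y, hy, hy'⟩)
    · exact ⟨⟨x, hx, Or.inl hx'⟩, y, hy, by simp [LexPos, hy'.not_gt, hy'.ne]⟩
    · exact ⟨⟨x, hx, Or.inr ⟨h0 x hx, hx'⟩⟩, y, hy, by simp [LexPos, h0 y hy, hy'.le]⟩
  exact G.card_signChanges_eq_two euler h.lexPos_rev (fun v => aux _ (h.vertex v))
    fun f => aux _ (h.face f)

/-- At a vertex where `ω` is not identically zero, `β` has constant sign on each run of zeros. -/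
theorem pos_iff_pos_rot (h : G.IsTieBroken ω β)
    (euler : 2 * (Fintype.card V + Nat.card G.Face) = Fintype.card D) {d e : D}
    (hde : G.tail e = G.tail d) (he : ω e ≠ 0) (h0 : ω d = 0) (h0' : ω (G.rot d) = 0) :
    0 < β d ↔ 0 < β (G.rot d) :=
  pos_iff_pos_of_card_signChanges_eq_two G.sameCycle_rot_iff h.ne_zero
    ((h.vertex (G.tail d)).resolve_right fun hz => he (hz.1 e hde))
    ((h.card_signChanges euler).1 _) ((h.neg_right.card_signChanges euler).1 _) rfl h0 h0'

/-- Along a face where `ω` is not identically zero, `β` has constant sign on each run of zeros. -/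
theorem pos_iff_pos_facePerm (h : G.IsTieBroken ω β)
    (euler : 2 * (Fintype.card V + Nat.card G.Face) = Fintype.card D) {d e : D}
    (hde : G.faceOf e = G.faceOf d) (he : ω e ≠ 0) (h0 : ω d = 0) (h0' : ω (G.facePerm d) = 0) :
    0 < β d ↔ 0 < β (G.facePerm d) :=
  pos_iff_pos_of_card_signChanges_eq_two G.sameCycle_facePerm_iff h.ne_zero
    ((h.face (G.faceOf d)).resolve_right fun hz => he (hz.1 e hde))
    ((h.card_signChanges euler).2 _) ((h.neg_right.card_signChanges euler).2 _) rfl h0 h0'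

/-- At a vertex where `ω` vanishes identically, `β` changes sign exactly twice. -/
theorem card_vertex_changes (h : G.IsTieBroken ω β)
    (euler : 2 * (Fintype.card V + Nat.card G.Face) = Fintype.card D) {v : V}
    (hv : ∀ d, G.tail d = v → ω d = 0) :
    (signChanges G.rot G.tail (fun d => 0 < β d) v).card = 2 := by
  rw [← (h.card_signChanges euler).1 v]
  congr 1
  ext d
  simp only [signChanges, Finset.mem_filter, Finset.mem_univ, true_and]
  refine and_congr_right fun hd => ?_
  simp [LexPos, hv d hd, hv (G.rot d) (by simpa using hd)]

/-- Along a face where `ω` vanishes identically, `β` changes sign exactly twice. -/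
theorem card_face_changes (h : G.IsTieBroken ω β)
    (euler : 2 * (Fintype.card V + Nat.card G.Face) = Fintype.card D) {f : G.Face}
    (hf : ∀ d, G.faceOf d = f → ω d = 0) :
    (signChanges G.facePerm G.faceOf (fun d => 0 < β d) f).card = 2 := by
  rw [← (h.card_signChanges euler).2 f]
  congr 1
  ext d
  simp only [signChanges, Finset.mem_filter, Finset.mem_univ, true_and]
  refine and_congr_right fun hd => ?_
  simp [LexPos, hf d hd, hf (G.facePerm d) (by simpa using hd)]

end IsTieBroken

end RotationGraph

/-! ### Components of the zero set -/

namespace RotationGraph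

variable {V D : Type*} (G : RotationGraph V D)

/-- The drawing is connected: a nonempty set of darts that is closed under reversal and rotation
consists of all darts. -/
def DartConnected : Prop :=
  ∀ X : Set D, X.Nonempty → (∀ d ∈ X, G.rev d ∈ X) → (∀ d ∈ X, G.rot d ∈ X) → X = Set.univ

/-- `T` is the set of darts of the connected component of `c` in the following graph. Its edges are
the edges on which `ω` vanishes. Its nodes are the vertices at which `ω` vanishes identically, and
the maximal runs of zeros of `ω` in the rotation at the other vertices. -/
structure IsZeroComponent (ω : D → ℝ) (c : D) (T : Finset D) : Prop where
  base_mem : c ∈ T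
  zero : ∀ d ∈ T, ω d = 0
  rev_mem : ∀ d ∈ T, G.rev d ∈ T
  rot_mem_iff : ∀ d, ω d = 0 → ω (G.rot d) = 0 → (G.rot d ∈ T ↔ d ∈ T)
  induct : ∀ P : D → Prop, P c → (∀ d ∈ T, P d → P (G.rev d)) →
    (∀ d ∈ T, G.rot d ∈ T → (P (G.rot d) ↔ P d)) → ∀ d ∈ T, P d

theorem exists_isZeroComponent [Fintype D] {ω : D → ℝ} (hω : ∀ d, ω (G.rev d) = -ω d) {c : D}
    (hc : ω c = 0) : ∃ T, G.IsZeroComponent ω c T := by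
  let R : D → D → Prop := fun d e => e = G.rev d ∨ (e = G.rot d ∧ ω d = 0 ∧ ω e = 0)
  have hzero : ∀ d e, Relation.EqvGen R d e → (ω d = 0 ↔ ω e = 0) := by
    intro d e h
    induction h with
    | rel x y h =>
      rcases h with rfl | ⟨rfl, h1, h2⟩
      · simp [hω]
      · simp [h1, h2]
    | refl => rfl
    | symm x y _ ih => exact ih.symm
    | trans x y z _ _ ih1 ih2 => exact ih1.trans ih2
  refine ⟨Finset.univ.filter fun e => Relation.EqvGen R c e, ?_, ?_, ?_, ?_, ?_⟩
  · simpa using Relation.EqvGen.refl c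
  · intro d hd
    exact (hzero c d (by simpa using hd)).1 hc
  · intro d hd
    simp only [Finset.mem_filter, Finset.mem_univ, true_and] at hd ⊢
    exact hd.trans _ _ _ (.rel _ _ (Or.inl rfl))
  · intro d h0 h1
    simp only [Finset.mem_filter, Finset.mem_univ, true_and]
    have : Relation.EqvGen R d (G.rot d) := .rel _ _ (Or.inr ⟨rfl, h0, h1⟩)
    exact ⟨fun h => h.trans _ _ _ (this.symm _ _), fun h => h.trans _ _ _ this⟩
  · intro P hPc hrev hrot d hd
    simp only [Finset.mem_filter, Finset.mem_univ, true_and] at hd hrev hrot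
    have key : ∀ x y, Relation.EqvGen R x y → Relation.EqvGen R c x → (P x ↔ P y) := by
      intro x y h
      induction h with
      | rel x y h =>
        intro hx
        rcases h with rfl | ⟨rfl, h1, h2⟩
        · refine ⟨hrev x hx, fun h => ?_⟩
          have := hrev (G.rev x) (hx.trans _ _ _ (.rel _ _ (Or.inl rfl))) h
          rwa [G.rev_rev] at this
        · exact (hrot x hx (hx.trans _ _ _ (.rel _ _ (Or.inr ⟨rfl, h1, h2⟩)))).symm
      | refl => exact fun _ => Iff.rfl
      | symm x y h ih => exact fun hy => (ih (hy.trans _ _ _ (h.symm _ _))).symm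
      | trans x y z h1 h2 ih1 ih2 => exact fun hx => (ih1 hx).trans (ih2 (hx.trans _ _ _ h1))
    exact (key c d hd (.refl c)).1 hPc

/-- The node of the graph of zeros of `ω` at which the dart `d` starts: its tail if all darts that
follow `d` in the rotation are zeros, and otherwise the last dart of the run of `d`. -/
noncomputable def zeroNode (ω : D → ℝ) (d : D) : V ⊕ D :=
  if h : ∃ n : ℕ, ω ((G.rot ^ (n + 1)) d) ≠ 0 then .inr ((G.rot ^ Nat.find h) d)
  else .inl (G.tail d)

variable {G}

theorem zeroNode_rot {ω : D → ℝ} {d : D} (hd : ω (G.rot d) = 0) :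
    G.zeroNode ω (G.rot d) = G.zeroNode ω d := by
  have e : ∀ n : ℕ, (G.rot ^ n) (G.rot d) = (G.rot ^ (n + 1)) d := fun n => by
    rw [pow_succ, Equiv.Perm.mul_apply]
  unfold zeroNode
  by_cases h : ∃ n : ℕ, ω ((G.rot ^ (n + 1)) d) ≠ 0
  · have h' : ∃ n : ℕ, ω ((G.rot ^ (n + 1)) (G.rot d)) ≠ 0 := by
      obtain ⟨n, hn⟩ := h
      cases n with
      | zero => simp [hd] at hn
      | succ n => exact ⟨n, by rwa [e]⟩
    rw [dif_pos h, dif_pos h', e]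
    congr 3
    symm
    rw [Nat.find_eq_iff]
    refine ⟨?_, ?_⟩
    · have := Nat.find_spec h'
      rwa [e] at this
    · intro m hm
      cases m with
      | zero => simpa using hd
      | succ m =>
        have := Nat.find_min h' (Nat.lt_of_succ_lt_succ hm)
        rwa [e] at this
  · have h' : ¬∃ n : ℕ, ω ((G.rot ^ (n + 1)) (G.rot d)) ≠ 0 := by
      rintro ⟨n, hn⟩
      exact h ⟨n + 1, by rwa [e] at hn⟩
    rw [dif_neg h, dif_neg h', tail_rot]

theorem zeroNode_of_ne {ω : D → ℝ} {d : D} (hd : ω (G.rot d) ≠ 0) :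
    G.zeroNode ω d = .inr d := by
  have h : ∃ n : ℕ, ω ((G.rot ^ (n + 1)) d) ≠ 0 := ⟨0, by simpa using hd⟩
  have : Nat.find h = 0 := by rw [Nat.find_eq_zero]; simpa using hd
  rw [zeroNode, dif_pos h, this]
  simp

theorem tail_rot_pow (n : ℕ) (d : D) : G.tail ((G.rot ^ n) d) = G.tail d :=
  ((G.sameCycle_rot_iff _ _).1 ⟨n, by simp⟩).symm

theorem elim_zeroNode (ω : D → ℝ) (d : D) :
    Sum.elim id G.tail (G.zeroNode ω d) = G.tail d := by
  unfold zeroNode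
  split_ifs with h
  · exact tail_rot_pow _ _
  · rfl

theorem zeroNode_of_forall {ω : D → ℝ} {d : D} (hd : ∀ e, G.tail e = G.tail d → ω e = 0) :
    G.zeroNode ω d = .inl (G.tail d) := by
  rw [zeroNode, dif_neg]
  rintro ⟨n, hn⟩
  exact hn (hd _ (tail_rot_pow _ _))

variable (G)

/-- The darts of `T` that are the last ones of their runs. -/
noncomputable def runEnds (T : Finset D) : Finset D := {d ∈ T | G.rot d ∉ T}

namespace IsZeroComponent

variable {G} {ω β : D → ℝ} {c : D} {T : Finset D}

theorem rev_mem_iff (hT : G.IsZeroComponent ω c T) (d : D) : G.rev d ∈ T ↔ d ∈ T :=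
  ⟨fun h => by simpa [G.rev_rev] using hT.rev_mem _ h, hT.rev_mem d⟩

theorem ne_zero_of_mem_runEnds (hT : G.IsZeroComponent ω c T) {d : D} (hd : d ∈ G.runEnds T) :
    ω (G.rot d) ≠ 0 := by
  simp only [runEnds, Finset.mem_filter] at hd
  exact fun h => hd.2 ((hT.rot_mem_iff d (hT.zero d hd.1) h).2 hd.1)

theorem runEnds_nonempty (hT : G.IsZeroComponent ω c T) (hconn : G.DartConnected)
    (hne : ∃ d, ω d ≠ 0) : (G.runEnds T).Nonempty := by
  by_contra hcon
  rw [Finset.not_nonempty_iff_eq_empty] at hcon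
  obtain ⟨d, hd⟩ := hne
  have := hconn (T : Set D) ⟨c, hT.base_mem⟩ hT.rev_mem fun d hd => by
    by_contra hr
    have : d ∈ G.runEnds T := by
      simp only [runEnds, Finset.mem_filter]
      exact ⟨hd, hr⟩
    simp [hcon] at this
  exact hd (hT.zero d (by have := this ▸ Set.mem_univ d; exact this))

theorem forall_mem_of_forall_pos (hT : G.IsZeroComponent ω c T) (h : G.IsTieBroken ω β)
    {g : D → ℝ} (hg : ∀ d, g (G.rev d) = -g d) (h0 : ∀ d ∈ T, 0 < β d → g d = 0) :
    ∀ d ∈ T, g d = 0 := by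
  intro d hd
  rcases lt_or_gt_of_ne (h.ne_zero d (hT.zero d hd)) with a | a
  · have := h0 (G.rev d) (hT.rev_mem d hd) (by rw [h.rev_right]; linarith)
    rwa [hg, neg_eq_zero] at this
  · exact h0 d hd a

theorem card_eq_two_mul (hT : G.IsZeroComponent ω c T) (h : G.IsTieBroken ω β) :
    T.card = 2 * {d ∈ T | 0 < β d}.card := by
  have : {d ∈ T | ¬0 < β d}.card = {d ∈ T | 0 < β d}.card := by
    refine Finset.card_equiv G.rev fun d => ?_
    simp only [Finset.mem_filter, hT.rev_mem_iff, h.rev_right]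
    refine and_congr_right fun hd => ?_
    rcases lt_or_gt_of_ne (h.ne_zero d (hT.zero d hd)) with a | a
    · simp [a, a.le]
    · simp [a, a.le]
  rw [← Finset.card_filter_add_card_filter_not (s := T) (fun d => 0 < β d), this]
  ring

theorem eq_zero_of_sum_mul_self (n : G.Face → ℝ)
    (h : ∑ d ∈ T, (n (G.faceOf d) - n (G.faceOf (G.rev d))) *
      (n (G.faceOf d) - n (G.faceOf (G.rev d))) = 0) :
    ∀ d ∈ T, n (G.faceOf d) - n (G.faceOf (G.rev d)) = 0 := fun d hd =>
  mul_self_eq_zero.1 ((Finset.sum_eq_zero_iff_of_nonneg fun _ _ => mul_self_nonneg _).1 h d hd)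

end IsZeroComponent

variable [Fintype D]

/-- The faces all of whose darts belong to `T`. -/
noncomputable def facesIn (T : Finset D) : Finset G.Face :=
  {f | ∀ d, G.faceOf d = f → d ∈ T}

namespace IsZeroComponent

variable {G} {ω β : D → ℝ} {c : D} {T : Finset D}

theorem mem_facesIn (hT : G.IsZeroComponent ω c T) {d : D} (hd : d ∈ T)
    (hf : ∀ e, G.faceOf e = G.faceOf d → ω e = 0) : G.faceOf d ∈ G.facesIn T := by
  simp only [facesIn, Finset.mem_filter, Finset.mem_univ, true_and]
  intro e he
  obtain ⟨n, rfl⟩ := ((G.sameCycle_facePerm_iff d e).2 he.symm).exists_nat_pow_eq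
  clear he
  induction n with
  | zero => simpa using hd
  | succ n ih =>
    rw [pow_succ', Equiv.Perm.mul_apply]
    have e1 : G.faceOf ((G.facePerm ^ n) d) = G.faceOf d :=
      ((G.sameCycle_facePerm_iff _ _).1 ⟨n, by simp⟩).symm
    exact (hT.rot_mem_iff _ (hT.zero _ (hT.rev_mem _ ih))
      (hf _ ((G.faceOf_facePerm _).trans e1))).2 (hT.rev_mem _ ih)

theorem mem_of_faceOf_mem {d : D} (hd : G.faceOf d ∈ G.facesIn T) : d ∈ T := by
  simp only [facesIn, Finset.mem_filter, Finset.mem_univ, true_and] at hd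
  exact hd d rfl

/-- All darts at a vertex where `ω` vanishes identically belong to `T` as soon as one does. -/
theorem mem_of_tail_eq (hT : G.IsZeroComponent ω c T) {d e : D} (hd : d ∈ T)
    (hz : ∀ x, G.tail x = G.tail d → ω x = 0) (he : G.tail e = G.tail d) : e ∈ T := by
  obtain ⟨n, rfl⟩ := ((G.sameCycle_rot_iff d e).2 he.symm).exists_nat_pow_eq
  clear he
  induction n with
  | zero => simpa using hd
  | succ n ih =>
    rw [pow_succ', Equiv.Perm.mul_apply]
    refine (hT.rot_mem_iff _ (hT.zero _ ih) (hz _ ?_)).2 ih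
    rw [tail_rot, tail_rot_pow]

/-! ### Differences and boundaries on a zero component -/

/-- Combinations of face boundaries are orthogonal to functions whose sums around faces vanish. -/
theorem sum_mul_face_eq_zero (hT : G.IsZeroComponent ω c T) {θ : D → ℝ} {n : G.Face → ℝ}
    (hn : ∀ f ∉ G.facesIn T, n f = 0) (hθ : ∀ d ∈ T, θ (G.rev d) = -θ d)
    (hface : ∀ f ∈ G.facesIn T, ∑ d with G.faceOf d = f, θ d = 0) :
    ∑ d ∈ T, θ d * (n (G.faceOf d) - n (G.faceOf (G.rev d))) = 0 := by
  have h1 : ∑ d ∈ T, θ d * n (G.faceOf d) = 0 := by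
    have : ∑ d ∈ T, θ d * n (G.faceOf d) = ∑ d, θ d * n (G.faceOf d) := by
      refine Finset.sum_subset (Finset.subset_univ _) fun d _ hd => ?_
      rw [hn _ fun hf => hd (mem_of_faceOf_mem hf), mul_zero]
    rw [this, ← Finset.sum_fiberwise _ G.faceOf]
    refine Finset.sum_eq_zero fun f _ => ?_
    by_cases hf : f ∈ G.facesIn T
    · rw [← zero_mul (n f), ← hface f hf, Finset.sum_mul]
      refine Finset.sum_congr rfl fun d hd => ?_
      simp only [Finset.mem_filter] at hd
      rw [hd.2]
    · refine Finset.sum_eq_zero fun d hd => ?_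
      simp only [Finset.mem_filter] at hd
      rw [hd.2, hn f hf, mul_zero]
  have h2 : ∑ d ∈ T, θ d * n (G.faceOf (G.rev d)) = -∑ d ∈ T, θ d * n (G.faceOf d) := by
    rw [← Finset.sum_neg_distrib]
    refine Finset.sum_equiv G.rev (fun d => (hT.rev_mem_iff d).symm) fun d hd => ?_
    rw [hθ d hd]; ring
  simp only [mul_sub, Finset.sum_sub_distrib, h2, h1]
  simp

/-- Differences of node functions sum to zero around the faces of the component. -/
theorem sum_face_zeroNode (hT : G.IsZeroComponent ω c T) (ψ : V ⊕ D → ℝ) {f : G.Face}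
    (hf : f ∈ G.facesIn T) :
    ∑ d with G.faceOf d = f, (ψ (G.zeroNode ω (G.rev d)) - ψ (G.zeroNode ω d)) = 0 := by
  rw [Finset.sum_sub_distrib, sub_eq_zero]
  refine Finset.sum_equiv G.facePerm (fun d => by simp) fun d hd => ?_
  simp only [Finset.mem_filter, Finset.mem_univ, true_and] at hd
  rw [facePerm_apply, zeroNode_rot]
  refine hT.zero _ ?_
  rw [← facePerm_apply]
  exact mem_of_faceOf_mem (by rwa [faceOf_facePerm, hd])

/-- Differences of node functions and combinations of face boundaries are independent, up to
constants, if `ω` is not identically zero: the component is not a closed surface then. -/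
theorem eq_zero_of_diff_add_boundary (hT : G.IsZeroComponent ω c T) (hconn : G.DartConnected)
    (hne : ∃ d, ω d ≠ 0) {ψ : V ⊕ D → ℝ} {n : G.Face → ℝ}
    (hn : ∀ f ∉ G.facesIn T, n f = 0) (hψ : ψ (G.zeroNode ω c) = 0)
    (h : ∀ d ∈ T, ψ (G.zeroNode ω (G.rev d)) - ψ (G.zeroNode ω d) +
      (n (G.faceOf d) - n (G.faceOf (G.rev d))) = 0) :
    (∀ d ∈ T, ψ (G.zeroNode ω d) = 0) ∧ ∀ f, n f = 0 := by
  have horth := hT.sum_mul_face_eq_zero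
    (θ := fun d => ψ (G.zeroNode ω (G.rev d)) - ψ (G.zeroNode ω d)) hn
    (fun d _ => by simp [G.rev_rev]) (fun f hf => hT.sum_face_zeroNode ψ hf)
  have hb := eq_zero_of_sum_mul_self n (by
    rw [← neg_eq_zero, ← Finset.sum_neg_distrib, ← horth]
    refine Finset.sum_congr rfl fun d hd => ?_
    rw [eq_neg_of_add_eq_zero_left (h d hd)]
    ring)
  constructor
  · refine hT.induct _ hψ (fun d hd h0 => ?_) fun d hd hd' => ?_
    · have := h d hd
      rw [hb d hd, h0] at this
      simpa using this
    · rw [zeroNode_rot (hT.zero _ hd')]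
  · by_contra hcon
    push Not at hcon
    obtain ⟨f, hf⟩ := hcon
    obtain ⟨e, rfl⟩ := G.faceOf_surjective f
    -- The darts beside faces with nonzero coefficient are closed under reversal and rotation.
    have hsub : ∀ d, n (G.faceOf d) ≠ 0 → d ∈ T := fun d hd =>
      mem_of_faceOf_mem (by by_contra hc; exact hd (hn _ hc))
    have hrev : ∀ d, n (G.faceOf d) ≠ 0 → n (G.faceOf (G.rev d)) ≠ 0 := fun d hd => by
      rwa [← sub_eq_zero.1 (hb d (hsub d hd))]
    have huniv := hconn {d | n (G.faceOf d) ≠ 0} ⟨e, hf⟩ hrev fun d hd => by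
      have := hrev d hd
      rwa [← faceOf_facePerm, facePerm_apply, G.rev_rev] at this
    obtain ⟨d, hd⟩ := hne
    have hmem : d ∈ {d | n (G.faceOf d) ≠ 0} := huniv ▸ Set.mem_univ d
    exact hd (hT.zero d (hsub d hmem))

end IsZeroComponent

variable [Fintype V]

/-! ### Counting runs -/

/-- The vertices in a set `T` of darts at which `ω` vanishes identically. -/
noncomputable def zeroVertices (ω : D → ℝ) (T : Finset D) : Finset V :=
  {v | (∃ d ∈ T, G.tail d = v) ∧ ∀ d, G.tail d = v → ω d = 0}

namespace IsZeroComponent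

variable {G} {ω β : D → ℝ} {c : D} {T : Finset D}

/-- The Euler characteristic of a zero component, with its nodes as vertices and with the faces
on which `ω` vanishes, is half its number of runs. -/
theorem card_eq (hT : G.IsZeroComponent ω c T) (h : G.IsTieBroken ω β)
    (euler : 2 * (Fintype.card V + Nat.card G.Face) = Fintype.card D) :
    T.card = 2 * (G.zeroVertices ω T).card + 2 * (G.facesIn T).card + (G.runEnds T).card := by
  have hA : {d ∈ T | G.rot d ∈ T ∧ ¬(0 < β d ↔ 0 < β (G.rot d))}.card =
      2 * (G.zeroVertices ω T).card := by
    rw [Finset.card_eq_sum_card_fiberwise (f := G.tail) (t := G.zeroVertices ω T)]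
    · rw [mul_comm, ← smul_eq_mul, ← Finset.sum_const]
      refine Finset.sum_congr rfl fun v hv => ?_
      simp only [zeroVertices, Finset.mem_filter, Finset.mem_univ, true_and] at hv
      rw [← h.card_vertex_changes euler hv.2]
      congr 1
      ext d
      simp only [signChanges, Finset.mem_filter, Finset.mem_univ, true_and]
      constructor
      · rintro ⟨⟨_, _, h1⟩, h2⟩
        exact ⟨h2, h1⟩
      · rintro ⟨h2, h1⟩
        obtain ⟨⟨e, he, hev⟩, hz⟩ := hv
        have hmem : ∀ x, G.tail x = v → x ∈ T := fun x hx =>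
          hT.mem_of_tail_eq he (hev ▸ hz) (hx.trans hev.symm)
        exact ⟨⟨hmem d h2, hmem _ (by rw [tail_rot, h2]), h1⟩, h2⟩
    · intro d hd
      simp only [Finset.coe_filter, Set.mem_ofPred_eq] at hd
      simp only [zeroVertices, Finset.coe_filter, Finset.mem_univ, true_and, Set.mem_ofPred_eq]
      refine ⟨⟨d, hd.1, rfl⟩, fun e he => ?_⟩
      by_contra hne
      exact hd.2.2 (h.pos_iff_pos_rot euler he hne (hT.zero d hd.1) (hT.zero _ hd.2.1))
  have hB : {d ∈ T | G.rot d ∈ T ∧ (0 < β d ↔ 0 < β (G.rot d))}.card =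
      2 * (G.facesIn T).card := by
    have hrev : {d ∈ T | G.rot d ∈ T ∧ (0 < β d ↔ 0 < β (G.rot d))}.card =
        {d ∈ T | G.facePerm d ∈ T ∧ ¬(0 < β d ↔ 0 < β (G.facePerm d))}.card := by
      refine Finset.card_equiv G.rev fun d => ?_
      rw [Finset.mem_filter, Finset.mem_filter]
      simp only [hT.rev_mem_iff, h.rev_right, facePerm_apply, G.rev_rev]
      refine and_congr_right fun hd => and_congr_right fun hd' => ?_
      rcases lt_or_gt_of_ne (h.ne_zero d (hT.zero d hd)) with a | a
      · simp [a, a.not_gt]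
      · simp [a, a.not_gt]
    rw [hrev, Finset.card_eq_sum_card_fiberwise (f := G.faceOf) (t := G.facesIn T)]
    · rw [mul_comm, ← smul_eq_mul, ← Finset.sum_const]
      refine Finset.sum_congr rfl fun f hf => ?_
      simp only [facesIn, Finset.mem_filter, Finset.mem_univ, true_and] at hf
      rw [← h.card_face_changes euler fun d hd => hT.zero d (hf d hd)]
      congr 1
      ext d
      simp only [signChanges, Finset.mem_filter, Finset.mem_univ, true_and]
      constructor
      · rintro ⟨⟨_, _, h1⟩, h2⟩
        exact ⟨h2, h1⟩
      · rintro ⟨h2, h1⟩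
        exact ⟨⟨hf d h2, hf _ (by rw [faceOf_facePerm, h2]), h1⟩, h2⟩
    · intro d hd
      simp only [Finset.coe_filter, Set.mem_ofPred_eq] at hd
      refine hT.mem_facesIn hd.1 fun e he => ?_
      by_contra hne
      exact hd.2.2 (h.pos_iff_pos_facePerm euler he hne (hT.zero d hd.1) (hT.zero _ hd.2.1))
  have h1 := Finset.card_filter_add_card_filter_not (s := T) (fun d => G.rot d ∈ T)
  have h2 := Finset.card_filter_add_card_filter_not (s := {d ∈ T | G.rot d ∈ T})
    (fun d => (0 < β d ↔ 0 < β (G.rot d)))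
  simp only [Finset.filter_filter] at h2
  rw [hA, hB] at h2
  rw [runEnds, ← h1, ← h2]
  ring

theorem zeroNode_mem (hT : G.IsZeroComponent ω c T) {d : D} (hd : d ∈ T) :
    G.zeroNode ω d ∈ (G.zeroVertices ω T).disjSum (G.runEnds T) := by
  unfold zeroNode
  split_ifs with h
  · rw [Finset.inr_mem_disjSum]
    have hmem : ∀ n ≤ Nat.find h, (G.rot ^ n) d ∈ T := by
      intro n
      induction n with
      | zero => intro _; simpa using hd
      | succ n ih =>
        intro hn
        have h1 := ih (by omega)
        have h2 := Nat.find_min h (show n < _ by omega)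
        rw [ne_eq, not_not] at h2
        rw [pow_succ', Equiv.Perm.mul_apply] at h2 ⊢
        exact (hT.rot_mem_iff _ (hT.zero _ h1) h2).2 h1
    simp only [runEnds, Finset.mem_filter]
    refine ⟨hmem _ le_rfl, fun hcon => Nat.find_spec h ?_⟩
    rw [pow_succ', Equiv.Perm.mul_apply]
    exact hT.zero _ hcon
  · rw [Finset.inl_mem_disjSum]
    simp only [zeroVertices, Finset.mem_filter, Finset.mem_univ, true_and]
    refine ⟨⟨d, hd, rfl⟩, fun e he => ?_⟩
    by_contra hne
    obtain ⟨n, hn⟩ := ((G.sameCycle_rot_iff (G.rot d) e).2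
      (by rw [tail_rot, he])).exists_nat_pow_eq
    exact h ⟨n, by rw [pow_succ, Equiv.Perm.mul_apply, hn]; exact hne⟩

/-! ### Zero components are simply connected -/

/-- Extension of a function by zero, as a linear map. -/
noncomputable def extendZero {K : Type*} (s : Finset K) : (s → ℝ) →ₗ[ℝ] (K → ℝ) where
  toFun x k := if h : k ∈ s then x ⟨k, h⟩ else 0
  map_add' x y := by ext k; by_cases h : k ∈ s <;> simp [h]
  map_smul' a x := by ext k; by_cases h : k ∈ s <;> simp [h]

theorem extendZero_of_mem {K : Type*} {s : Finset K} (x : s → ℝ) (k : s) :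
    extendZero s x k = x k := by simp [extendZero]

theorem extendZero_of_notMem {K : Type*} {s : Finset K} (x : s → ℝ) {k : K} (hk : k ∉ s) :
    extendZero s x k = 0 := by simp [extendZero, hk]

/-- The linear map that sends a function on the nodes other than the node of `c`, and a function on
the faces of the component, to the sum of the difference of the first and the boundary of the
second; its values are recorded for one dart of each edge. -/
noncomputable def diffAddBoundary (G : RotationGraph V D) (ω β : D → ℝ) (c : D) (T : Finset D) :
    ((((G.zeroVertices ω T).disjSum (G.runEnds T)).erase (G.zeroNode ω c) → ℝ) ×
      (G.facesIn T → ℝ)) →ₗ[ℝ] ({d ∈ T | 0 < β d} → ℝ) where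
  toFun x d := extendZero _ x.1 (G.zeroNode ω (G.rev d)) - extendZero _ x.1 (G.zeroNode ω d) +
      (extendZero _ x.2 (G.faceOf d) - extendZero _ x.2 (G.faceOf (G.rev d)))
  map_add' x y := by ext d; simp; ring
  map_smul' a x := by ext d; simp; ring

theorem diffAddBoundary_injective (hT : G.IsZeroComponent ω c T) (h : G.IsTieBroken ω β)
    (hconn : G.DartConnected) (hne : ∃ d, ω d ≠ 0) :
    Function.Injective (diffAddBoundary G ω β c T) := by
  rw [injective_iff_map_eq_zero]
  rintro ⟨x, y⟩ hxy
  have h0 := hT.forall_mem_of_forall_pos h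
    (g := fun d => extendZero _ x (G.zeroNode ω (G.rev d)) - extendZero _ x (G.zeroNode ω d) +
      (extendZero _ y (G.faceOf d) - extendZero _ y (G.faceOf (G.rev d))))
    (fun d => by simp only [G.rev_rev]; ring)
    (fun d hd hpos => congrFun hxy ⟨d, Finset.mem_filter.2 ⟨hd, hpos⟩⟩)
  obtain ⟨h1, h2⟩ := hT.eq_zero_of_diff_add_boundary hconn hne
    (fun f hf => extendZero_of_notMem y hf)
    (extendZero_of_notMem x (Finset.notMem_erase _ _)) h0
  ext k
  · change x k = 0
    rw [← extendZero_of_mem x k]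
    have hk := (Finset.mem_erase.1 k.2).2
    rcases hk' : (k : V ⊕ D) with v | d
    · rw [hk', Finset.inl_mem_disjSum] at hk
      simp only [zeroVertices, Finset.mem_filter, Finset.mem_univ, true_and] at hk
      obtain ⟨⟨d, hd, rfl⟩, hz⟩ := hk
      rw [← zeroNode_of_forall hz]
      exact h1 d hd
    · rw [hk', Finset.inr_mem_disjSum] at hk
      rw [← zeroNode_of_ne (hT.ne_zero_of_mem_runEnds hk)]
      exact h1 d (Finset.mem_filter.1 hk).1
  · change y k = 0
    rw [← extendZero_of_mem y k]
    exact h2 k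

/-- If `ω` is not identically zero, a component has at most two runs, and every function whose sums
around the faces vanish is the difference of a function on its nodes: the component is simply
connected. -/
theorem card_runEnds_le_two_and_exact (hT : G.IsZeroComponent ω c T) (h : G.IsTieBroken ω β)
    (euler : 2 * (Fintype.card V + Nat.card G.Face) = Fintype.card D)
    (hconn : G.DartConnected) (hne : ∃ d, ω d ≠ 0) :
    (G.runEnds T).card ≤ 2 ∧ ∀ θ : D → ℝ, (∀ d, θ (G.rev d) = -θ d) →
      (∀ f, ∑ d with G.faceOf d = f, θ d = 0) →
      ∃ ψ : V ⊕ D → ℝ, ∀ d ∈ T, θ d = ψ (G.zeroNode ω (G.rev d)) - ψ (G.zeroNode ω d) := by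
  have hinj := hT.diffAddBoundary_injective h hconn hne
  have hle := LinearMap.finrank_le_finrank_of_injective hinj
  have hdom : Module.finrank ℝ
      ((((G.zeroVertices ω T).disjSum (G.runEnds T)).erase (G.zeroNode ω c) → ℝ) ×
      (G.facesIn T → ℝ)) =
      (G.zeroVertices ω T).card + (G.runEnds T).card - 1 + (G.facesIn T).card := by
    rw [Module.finrank_prod, Module.finrank_fintype_fun_eq_card,
      Module.finrank_fintype_fun_eq_card, Fintype.card_coe, Fintype.card_coe,
      Finset.card_erase_of_mem (hT.zeroNode_mem hT.base_mem), Finset.card_disjSum]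
  have hcod : Module.finrank ℝ ({d ∈ T | 0 < β d} → ℝ) = {d ∈ T | 0 < β d}.card := by
    rw [Module.finrank_fintype_fun_eq_card, Fintype.card_coe]
  have h1 := hT.card_eq h euler
  have h2 := hT.card_eq_two_mul h
  have h3 := (hT.runEnds_nonempty hconn hne).card_pos
  refine ⟨by omega, fun θ hθ hface => ?_⟩
  have hsurj := (LinearMap.injective_iff_surjective_of_finrank_eq_finrank
    (f := diffAddBoundary G ω β c T) (by omega)).1 hinj
  obtain ⟨⟨x, y⟩, hxy⟩ := hsurj fun d => θ d
  refine ⟨extendZero _ x, ?_⟩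
  have h0 := hT.forall_mem_of_forall_pos h
    (g := fun d => extendZero _ x (G.zeroNode ω (G.rev d)) - extendZero _ x (G.zeroNode ω d) +
      (extendZero _ y (G.faceOf d) - extendZero _ y (G.faceOf (G.rev d))) - θ d)
    (fun d => by simp only [G.rev_rev, hθ]; ring)
    (fun d hd hpos => sub_eq_zero.2 (congrFun hxy ⟨d, Finset.mem_filter.2 ⟨hd, hpos⟩⟩))
  have hn : ∀ f ∉ G.facesIn T, extendZero _ y f = 0 := fun f hf => extendZero_of_notMem y hf
  -- The boundary part is orthogonal to `θ` and to the difference part, hence to itself.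
  have o1 := hT.sum_mul_face_eq_zero hn (fun d _ => hθ d) fun f _ => hface f
  have o2 := hT.sum_mul_face_eq_zero
    (θ := fun d => extendZero _ x (G.zeroNode ω (G.rev d)) - extendZero _ x (G.zeroNode ω d)) hn
    (fun d _ => by simp [G.rev_rev]) (fun f hf => hT.sum_face_zeroNode _ hf)
  have hb := eq_zero_of_sum_mul_self (extendZero (G.facesIn T) y) (T := T) (by
    rw [← sub_zero (0 : ℝ)]
    nth_rw 1 [← o1]
    rw [← o2, ← Finset.sum_sub_distrib]
    refine Finset.sum_congr rfl fun d hd => ?_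
    rw [← sub_mul]
    congr 1
    linarith [h0 d hd])
  intro d hd
  have := h0 d hd
  rw [hb d hd] at this
  linarith

end IsZeroComponent

end RotationGraph

/-! ### Orderings without interior local extrema -/

/-- On the finite set `S`, the function `φ` is injective, and every element of `S` outside `B` has
a neighbor in `S` with a larger value and a neighbor in `S` with a smaller value. -/
def NoLocalExtremum {V : Type*} (adj : V → V → Prop) (B : Set V) (S : Finset V) (φ : V → ℝ) :
    Prop :=
  Set.InjOn φ S ∧ ∀ v ∈ S, v ∉ B →
    (∃ x ∈ S, adj v x ∧ φ v < φ x) ∧ ∃ y ∈ S, adj v y ∧ φ y < φ v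

/-- A path outside `S` that joins two distinct elements of `S` can be added to `S`: its values are
chosen increasing, between the values of the two ends and just above the smaller one. -/
theorem NoLocalExtremum.exists_extension {V : Type*} {adj : V → V → Prop}
    (hadj : ∀ x y, adj x y → adj y x) {B : Set V} {S : Finset V} {φ : V → ℝ}
    (h : NoLocalExtremum adj B S φ) {l : List V} (hl : l ≠ []) (hnodup : l.Nodup)
    (hlS : ∀ x ∈ l, x ∉ S) (hchain : l.IsChain adj) {w w' : V} (hw : w ∈ S) (hw' : w' ∈ S)
    (h1 : adj (l.head hl) w) (h2 : adj (l.getLast hl) w') (hlt : φ w < φ w') :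
    ∃ φ', NoLocalExtremum adj B (S ∪ l.toFinset) φ' := by
  obtain ⟨m, hm1, hm2, hm3⟩ : ∃ m, φ w < m ∧ m ≤ φ w' ∧ ∀ x ∈ S, φ w < φ x → m ≤ φ x := by
    have hne : (S.filter fun x => φ w < φ x).Nonempty := ⟨w', by simp [hw', hlt]⟩
    obtain ⟨y, hy, hmin⟩ := Finset.exists_min_image _ φ hne
    simp only [Finset.mem_filter] at hy hmin
    exact ⟨φ y, hy.2, hmin w' ⟨hw', hlt⟩, fun x hx hx' => hmin x ⟨hx, hx'⟩⟩
  have hk : (0 : ℝ) < l.length + 1 := by positivity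
  let g : ℕ → ℝ := fun i => φ w + (m - φ w) * ((i + 1) / (l.length + 1))
  have hg : StrictMono g := by
    intro i j hij
    have : (i : ℝ) < j := by exact_mod_cast hij
    have h0 : 0 < m - φ w := by linarith
    have : ((i : ℝ) + 1) / (l.length + 1) < (j + 1) / (l.length + 1) := by gcongr
    simp only [g]
    gcongr
  have hg0 : ∀ i, φ w < g i := by
    intro i
    have h0 : 0 < m - φ w := by linarith
    have : 0 < (m - φ w) * (((i : ℝ) + 1) / (l.length + 1)) := by positivity
    simp only [g]; linarith
  have hg1 : ∀ i < l.length, g i < m := by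
    intro i hi
    have := hg hi
    have e : g l.length = m := by simp only [g]; rw [div_self hk.ne']; ring
    rwa [e] at this
  let φ' : V → ℝ := fun x => if x ∈ S then φ x else g (l.idxOf x)
  have e1 : ∀ x ∈ S, φ' x = φ x := fun x hx => if_pos hx
  have e2 : ∀ x ∈ l, φ' x = g (l.idxOf x) := fun x hx => if_neg (hlS x hx)
  have e3 : ∀ i (hi : i < l.length), φ' l[i] = g i := fun i hi => by
    rw [e2 _ (List.getElem_mem hi), hnodup.idxOf_getElem]
  have hmixed : ∀ x ∈ S, ∀ y ∈ l, φ x ≠ g (l.idxOf y) := by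
    intro x hx y hy heq
    have a := hg0 (l.idxOf y)
    have b := hg1 _ (List.idxOf_lt_length_of_mem hy)
    have := hm3 x hx (heq ▸ a)
    linarith
  refine ⟨φ', ?_, ?_⟩
  · intro x hx y hy hxy
    simp only [Finset.coe_union, Set.mem_union, Finset.mem_coe, List.mem_toFinset] at hx hy
    rcases hx with hx | hx <;> rcases hy with hy | hy
    · exact h.1 hx hy (by rwa [e1 x hx, e1 y hy] at hxy)
    · exact absurd (by rwa [e1 x hx, e2 y hy] at hxy) (hmixed x hx y hy)
    · exact absurd (by rw [e2 x hx, e1 y hy] at hxy; exact hxy.symm) (hmixed y hy x hx)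
    · rw [e2 x hx, e2 y hy] at hxy
      exact (List.idxOf_inj hx).1 (hg.injective hxy)
  · intro v hv hvB
    rw [Finset.mem_union, List.mem_toFinset] at hv
    rcases hv with hv | hv
    · obtain ⟨⟨x, hx, hx1, hx2⟩, y, hy, hy1, hy2⟩ := h.2 v hv hvB
      refine ⟨⟨x, Finset.mem_union_left _ hx, hx1, ?_⟩, y, Finset.mem_union_left _ hy, hy1, ?_⟩
      · rwa [e1 v hv, e1 x hx]
      · rwa [e1 v hv, e1 y hy]
    · obtain ⟨i, hi, rfl⟩ := List.getElem_of_mem hv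
      constructor
      · by_cases hi' : i + 1 < l.length
        · refine ⟨l[i + 1], by simp, hchain.getElem i hi', ?_⟩
          rw [e3, e3]
          exact hg (Nat.lt_succ_self i)
        · refine ⟨w', Finset.mem_union_left _ hw', ?_, ?_⟩
          · have : i = l.length - 1 := by omega
            subst this
            rwa [← List.getLast_eq_getElem]
          · rw [e3, e1 w' hw']
            exact (hg1 i hi).trans_le hm2
      · rcases i with _ | i
        · refine ⟨w, Finset.mem_union_left _ hw, ?_, ?_⟩
          · rwa [← List.head_eq_getElem]
          · rw [e3, e1 w hw]
            exact hg0 0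
        · refine ⟨l[i], by simp, hadj _ _ (hchain.getElem i hi), ?_⟩
          rw [e3, e3]
          exact hg (Nat.lt_succ_self i)

/-- If every proper subset that contains `B` has an ear, then there is an injective function
without local extrema outside `B`. -/
theorem exists_noLocalExtremum {V : Type*} [Fintype V] {adj : V → V → Prop}
    (hadj : ∀ x y, adj x y → adj y x) {B : Set V}
    (hear : ∀ S : Finset V, B ⊆ S → S ≠ Finset.univ → ∃ l : List V, ∃ hl : l ≠ [], l.Nodup ∧
      (∀ x ∈ l, x ∉ S) ∧ l.IsChain adj ∧
      ∃ w ∈ S, ∃ w' ∈ S, w ≠ w' ∧ adj (l.head hl) w ∧ adj (l.getLast hl) w') :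
    ∃ φ, NoLocalExtremum adj B Finset.univ φ := by
  have main : ∀ n : ℕ, ∀ S : Finset V, B ⊆ S → (Sᶜ).card = n →
      (∃ φ, NoLocalExtremum adj B S φ) → ∃ φ, NoLocalExtremum adj B Finset.univ φ := by
    intro n
    induction n using Nat.strong_induction_on with
    | _ n ih =>
      rintro S hBS hn ⟨φ, hφ⟩
      by_cases hS : S = Finset.univ
      · exact ⟨φ, hS ▸ hφ⟩
      obtain ⟨l, hl, hnodup, hlS, hchain, w, hw, w', hw', hne, h1, h2⟩ := hear S hBS hS
      refine ih ((S ∪ l.toFinset)ᶜ).card ?_ (S ∪ l.toFinset)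
        (hBS.trans (by simp)) rfl ?_
      · rw [← hn]
        refine Finset.card_lt_card ⟨?_, fun hsub => ?_⟩
        · rw [Finset.compl_subset_compl]
          exact Finset.subset_union_left
        · rw [Finset.compl_subset_compl] at hsub
          refine hlS _ (List.head_mem hl) (hsub ?_)
          simp
      · have hφne : φ w ≠ φ w' := fun h => hne (hφ.1 hw hw' h)
        rcases lt_or_gt_of_ne hφne with hlt | hlt
        · exact hφ.exists_extension hadj hl hnodup hlS hchain hw hw' h1 h2 hlt
        · have hl' : l.reverse ≠ [] := by simpa using hl
          have := hφ.exists_extension hadj hl' (List.nodup_reverse.2 hnodup)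
            (by simpa using hlS) (l := l.reverse)
            (by rw [List.isChain_reverse]; exact hchain.imp fun a b hab => hadj _ _ hab)
            hw' hw (by simpa using h2) (by simpa using h1) hlt
          simpa using this
  refine main _ (Finset.univ.filter fun v => v ∈ B) (fun v hv => by simpa using hv) rfl ?_
  refine ⟨fun v => (Fintype.equivFin V v : ℕ), fun x _ y _ hxy => ?_, fun v hv hvB => ?_⟩
  · exact (Fintype.equivFin V).injective (Fin.ext (Nat.cast_injective hxy))
  · exact absurd (by simpa using hv) hvB

namespace TorusGraph

variable {V D : Type*} [Fintype V] [Fintype D] (G : TorusGraph V D)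

/-! ### Connectivity of the universal cover -/

variable {G}

/-- A property of the vertices of the universal cover that is preserved along edges avoiding a set
of at most two vertices holds at all other vertices as soon as it holds at one of them. -/
theorem EssentiallyThreeConnected.induct (hG : G.EssentiallyThreeConnected)
    (S : Finset (V × (Fin 2 → ℤ))) (hS : S.card ≤ 2) (P : V × (Fin 2 → ℤ) → Prop)
    {x₀ : V × (Fin 2 → ℤ)} (hx₀ : x₀ ∉ S) (h₀ : P x₀)
    (step : ∀ x d, P x → G.tail d = x.1 → (G.head d, x.2 + G.transl d) ∉ S →
      P (G.head d, x.2 + G.transl d)) : ∀ y ∉ S, P y := by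
  intro y hy
  have hreach := (hG.2 S hS).preconnected ⟨x₀, by simpa using hx₀⟩ ⟨y, by simpa using hy⟩
  rw [SimpleGraph.reachable_iff_reflTransGen] at hreach
  have : ∀ z, Relation.ReflTransGen
      (G.cover.induce ((S : Set (V × (Fin 2 → ℤ)))ᶜ)).Adj ⟨x₀, by simpa using hx₀⟩ z → P z.1 := by
    intro z hz
    induction hz with
    | refl => exact h₀
    | @tail b z _ hbz ih =>
      obtain ⟨_, d, h1, h2, h3⟩ := hbz
      have e : (z : V × (Fin 2 → ℤ)) = (G.head d, b.1.2 + G.transl d) := Prod.ext h2.symm h3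
      rw [e]
      refine step b.1 d ih h1 ?_
      rw [← e]
      exact fun h => z.2 (Finset.mem_coe.2 h)
  exact this _ hreach

theorem EssentiallyThreeConnected.dartConnected (hG : G.EssentiallyThreeConnected) :
    G.DartConnected := by
  rintro X ⟨c, hc⟩ hrev hrot
  have hcyc : ∀ d ∈ X, ∀ e, G.tail e = G.tail d → e ∈ X := by
    intro d hd e he
    obtain ⟨n, rfl⟩ := ((G.sameCycle_rot_iff d e).2 he.symm).exists_nat_pow_eq
    clear he
    induction n with
    | zero => simpa using hd
    | succ n ih =>
      rw [pow_succ', Equiv.Perm.mul_apply]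
      exact hrot _ ih
  have := hG.induct ∅ (by simp) (fun x => ∀ e, G.tail e = x.1 → e ∈ X)
    (x₀ := (G.tail c, 0)) (by simp) (hcyc c hc)
    (fun x d hx hd _ => hcyc (G.rev d) (hrev d (hx d hd)))
  exact Set.eq_univ_of_forall fun d => this (G.tail d, 0) (by simp) d rfl

theorem EssentiallyThreeConnected.exists_tail_eq (hG : G.EssentiallyThreeConnected) (c : D)
    (v : V) : ∃ d, G.tail d = v :=
  hG.induct ∅ (by simp) (fun x => ∃ d, G.tail d = x.1) (x₀ := (G.tail c, 0)) (by simp) ⟨c, rfl⟩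
    (fun _ d _ _ _ => ⟨G.rev d, rfl⟩) (v, 0) (by simp)

/-! ### Displacements -/

variable (G) in
/-- The displacement along (a lift of) the dart `d` when the vertices are placed at `p`. -/
def displ (p : V → Fin 2 → ℝ) (d : D) : Fin 2 → ℝ :=
  p (G.head d) - p (G.tail d) + fun i => (G.transl d i : ℝ)

theorem head_rev (d : D) : G.head (G.rev d) = G.tail d := by
  rw [DartGraph.head, G.rev_rev]

theorem displ_rev (p : V → Fin 2 → ℝ) (d : D) : G.displ p (G.rev d) = -G.displ p d := by
  ext i
  have : G.tail (G.rev d) = G.head d := rfl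
  simp only [displ, head_rev, this, G.transl_rev, Pi.add_apply, Pi.sub_apply, Pi.neg_apply,
    Int.cast_neg]
  ring

theorem sum_face_transl (f : G.Face) (i : Fin 2) :
    ∑ d with G.faceOf d = f, (G.transl d i : ℝ) = 0 := by
  obtain ⟨c, rfl⟩ := G.faceOf_surjective f
  have h := G.transl_face c
  rw [finsum_mem_eq_finite_toFinset_sum _ (Set.toFinite _)] at h
  have h' := congrFun h i
  rw [Finset.sum_apply, Pi.zero_apply] at h'
  have h'' : ((∑ d ∈ (Set.toFinite {e | G.facePerm.SameCycle c e}).toFinset, G.transl d i : ℤ) : ℝ)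
      = 0 := by rw [h']; simp
  rw [← h'']
  push_cast
  refine Finset.sum_congr ?_ fun _ _ => rfl
  ext d
  simp [G.sameCycle_facePerm_iff, eq_comm]

theorem sum_face_head_sub_tail (f : G.Face) (φ : V → ℝ) :
    ∑ d with G.faceOf d = f, (φ (G.head d) - φ (G.tail d)) = 0 := by
  rw [Finset.sum_sub_distrib, sub_eq_zero]
  refine Finset.sum_equiv G.facePerm (fun d => by simp) fun d _ => ?_
  rw [G.tail_facePerm]

theorem sum_face_displ (p : V → Fin 2 → ℝ) (f : G.Face) :
    ∑ d with G.faceOf d = f, G.displ p d = 0 := by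
  ext i
  rw [Finset.sum_apply, Pi.zero_apply]
  simp only [displ, Pi.add_apply, Pi.sub_apply]
  rw [Finset.sum_add_distrib, G.sum_face_transl, add_zero]
  exact G.sum_face_head_sub_tail f fun v => p v i

/-- The vertices are in equilibrium when all darts have weight `1`. -/
def IsEquilibrium (G : TorusGraph V D) (p : V → Fin 2 → ℝ) : Prop :=
  ∀ v, ∑ d with G.tail d = v, G.displ p d = 0

/-- The displacements span the plane. -/
theorem EssentiallyThreeConnected.exists_dotProduct_ne_zero (hG : G.EssentiallyThreeConnected)
    (c : D) (p : V → Fin 2 → ℝ) {a : Fin 2 → ℝ} (ha : a ≠ 0) : ∃ d, a ⬝ᵥ G.displ p d ≠ 0 := by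
  by_contra! hcon
  apply ha
  -- Otherwise the lifts of `p` lie on a line perpendicular to `a`, which is absurd for all lifts
  -- of one vertex.
  have := hG.induct ∅ (by simp)
    (fun x => a ⬝ᵥ (p x.1 + fun i => (x.2 i : ℝ)) = a ⬝ᵥ p (G.tail c))
    (x₀ := (G.tail c, 0)) (by simp) (by simp [dotProduct]) (fun x d hx hd _ => by
      have h := hcon d
      simp only [displ, hd, dotProduct, Fin.sum_univ_two, Pi.add_apply, Pi.sub_apply,
        Int.cast_add] at h hx ⊢
      linarith)
  ext i
  have h := this (G.tail c, Pi.single i 1) (by simp)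
  have e : (fun j => ((Pi.single i 1 : Fin 2 → ℤ) j : ℝ)) = Pi.single i 1 := by
    ext j; by_cases hj : j = i
    · subst hj; simp
    · simp [hj]
  simp only [e, dotProduct_add, dotProduct_single, mul_one] at h
  simpa using h

/-! ### Vertices with all edges on a line -/

/-- In a 3-connected drawing in equilibrium, the edges at a vertex do not all lie on a line. If
they did, the zero component of such a vertex would lift to a part of the universal cover that is
attached to the rest at no more than two vertices, the tails of its two runs. -/
theorem EssentiallyThreeConnected.exists_dart_dotProduct_ne_zero
    (hG : G.EssentiallyThreeConnected) (p : V → Fin 2 → ℝ) {a : Fin 2 → ℝ} (ha : a ≠ 0) {β : D → ℝ}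
    (h : G.IsTieBroken (fun d => a ⬝ᵥ G.displ p d) β) (c : D) :
    ∃ e, G.tail e = G.tail c ∧ a ⬝ᵥ G.displ p e ≠ 0 := by
  by_contra! hz
  set ω : D → ℝ := fun d => a ⬝ᵥ G.displ p d with hω
  obtain ⟨T, hT⟩ := G.exists_isZeroComponent h.rev_left (hz c rfl)
  obtain ⟨hcard, hexact⟩ := hT.card_runEnds_le_two_and_exact h G.euler hG.dartConnected
    (hG.exists_dotProduct_ne_zero c p ha)
  have hτ : ∀ i : Fin 2, ∃ ψ : V ⊕ D → ℝ, ∀ d ∈ T,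
      (G.transl d i : ℝ) = ψ (G.zeroNode ω (G.rev d)) - ψ (G.zeroNode ω d) := fun i =>
    hexact (fun d => (G.transl d i : ℝ)) (fun d => by simp [G.transl_rev])
      (fun f => G.sum_face_transl f i)
  choose ψ hψ using hτ
  -- The component is lifted by `ψ`, normalized to `0` at the node of `c`. The values of `ψ` are
  -- integers then; taking integral parts spares a proof.
  let S : Finset (V × (Fin 2 → ℤ)) := (G.runEnds T).image fun r =>
    (G.tail r, fun i => ⌊ψ i (.inr r) - ψ i (G.zeroNode ω c)⌋)
  have hSne : ∀ x ∈ S, x.1 ≠ G.tail c := by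
    intro x hx hxc
    obtain ⟨r, hr, rfl⟩ := Finset.mem_image.1 hx
    exact hT.ne_zero_of_mem_runEnds hr (hz _ (by rw [G.tail_rot]; exact hxc))
  have key := hG.induct S (Finset.card_image_le.trans hcard)
    (fun x => (∀ e, G.tail e = x.1 → ω e = 0) ∧
      ∃ d ∈ T, G.tail d = x.1 ∧ ∀ i, (x.2 i : ℝ) = ψ i (G.zeroNode ω d) - ψ i (G.zeroNode ω c))
    (x₀ := (G.tail c, 0)) (fun hx => hSne _ hx rfl)
    ⟨hz, c, hT.base_mem, rfl, fun i => by simp⟩ (by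
      rintro ⟨v, z⟩ e ⟨hv, d, hd, rfl, hdz⟩ he hS
      simp only at hv he hS hdz ⊢
      have heT : e ∈ T := hT.mem_of_tail_eq hd hv he
      have hnode : G.zeroNode ω e = G.zeroNode ω d := by
        rw [G.zeroNode_of_forall hv, G.zeroNode_of_forall (he ▸ hv), he]
      have hcoord : ∀ i, (((z + G.transl e) i : ℤ) : ℝ) =
          ψ i (G.zeroNode ω (G.rev e)) - ψ i (G.zeroNode ω c) := by
        intro i
        rw [Pi.add_apply, Int.cast_add, hdz i, hψ i e heT, hnode]
        ring
      have hrT := hT.rev_mem e heT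
      have hmem := hT.zeroNode_mem hrT
      have htail := G.elim_zeroNode ω (G.rev e)
      rcases hnr : G.zeroNode ω (G.rev e) with v' | r
      · rw [hnr] at hmem htail
        rw [Finset.inl_mem_disjSum] at hmem
        refine ⟨fun x hx => (Finset.mem_filter.1 hmem).2.2 x ?_, G.rev e, hrT, rfl, hcoord⟩
        exact hx.trans htail.symm
      · rw [hnr] at hmem htail
        rw [Finset.inr_mem_disjSum] at hmem
        refine absurd (Finset.mem_image.2 ⟨r, hmem, ?_⟩) hS
        refine Prod.ext htail (funext fun i => ?_)
        have := hcoord i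
        rw [hnr] at this
        simp only
        rw [← this, Int.floor_intCast])
  obtain ⟨_, d, hd, hdc, hdz⟩ := key (G.tail c, fun _ => 1) fun hx => hSne _ hx rfl
  have hnode : G.zeroNode ω d = G.zeroNode ω c := by
    rw [G.zeroNode_of_forall hz, G.zeroNode_of_forall (hdc ▸ hz), hdc]
  have := hdz 0
  rw [hnode] at this
  simp at this

end TorusGraph

namespace TorusGraph

variable {V D : Type*} [Fintype V] [Fintype D] {G : TorusGraph V D}

/-! ### Breaking ties -/

theorem EssentiallyThreeConnected.tail_ne_head (hG : G.EssentiallyThreeConnected)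
    {p : V → Fin 2 → ℝ} {d : D} (hd : G.displ p d = 0) : G.tail d ≠ G.head d := by
  intro h
  refine hG.1 d h (funext fun i => ?_)
  have := congrFun hd i
  simpa [displ, h] using this

/-- There is an injective function of the vertices that has no local extremum at the vertices
all of whose darts have displacement `0`. Ears are found as follows: the lifts of a connected set
of such vertices share one position, so that a path that leaves the set must reach it from a
vertex other than a given neighbor `w`, once the lift of `w` at this position is removed from the
universal cover. -/
theorem EssentiallyThreeConnected.exists_noLocalExtremum (hG : G.EssentiallyThreeConnected)
    (c : D) (p : V → Fin 2 → ℝ) :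
    ∃ φ, NoLocalExtremum (fun x y => ∃ d, G.tail d = x ∧ G.head d = y)
      {v | ∃ d, G.tail d = v ∧ G.displ p d ≠ 0} Finset.univ φ := by
  set adj : V → V → Prop := fun x y => ∃ d, G.tail d = x ∧ G.head d = y with hadj_def
  have hadj : ∀ x y, adj x y → adj y x := by
    rintro x y ⟨d, rfl, rfl⟩
    exact ⟨G.rev d, rfl, head_rev d⟩
  refine _root_.exists_noLocalExtremum hadj fun S hBS hS => ?_
  have hzero : ∀ d, G.tail d ∉ S → G.displ p d = 0 := fun d hd => by
    by_contra hne
    exact hd (hBS ⟨d, rfl, hne⟩)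
  obtain ⟨d, hdS, hw⟩ : ∃ d, G.tail d ∉ S ∧ G.head d ∈ S := by
    by_contra! hcon
    obtain ⟨e, he⟩ := hG.exists_dotProduct_ne_zero c p (a := Pi.single 0 1) (by simp)
    have heS : G.tail e ∈ S := hBS ⟨e, rfl, fun h0 => he (by rw [h0, dotProduct_zero])⟩
    have huniv := hG.dartConnected {d | G.tail d ∈ S} ⟨e, heS⟩
      (fun d hd => by
        by_contra hc
        refine hcon (G.rev d) hc ?_
        rw [head_rev]
        exact hd)
      (fun d hd => by
        change G.tail (G.rot d) ∈ S
        rw [G.tail_rot]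
        exact hd)
    refine hS (Finset.eq_univ_of_forall fun v => ?_)
    obtain ⟨x, rfl⟩ := hG.exists_tail_eq c v
    have hx : x ∈ {d | G.tail d ∈ S} := huniv ▸ Set.mem_univ x
    exact hx
  let K : SimpleGraph V := SimpleGraph.fromRel fun x y => x ∉ S ∧ y ∉ S ∧ adj x y
  have hKadj : ∀ x y, K.Adj x y → x ∉ S ∧ y ∉ S ∧ adj x y := by
    rintro x y ⟨_, h | h⟩
    · exact h
    · exact ⟨h.2.1, h.1, hadj _ _ h.2.2⟩
  have hreach : ∀ x, K.Reachable (G.tail d) x → x ∉ S := by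
    intro x hx
    rw [SimpleGraph.reachable_iff_reflTransGen] at hx
    rcases Relation.ReflTransGen.cases_tail hx with h | ⟨y, _, h⟩
    · exact h ▸ hdS
    · exact (hKadj _ _ h).2.1
  obtain ⟨x, w', hx, hw', hne, hxw⟩ :
      ∃ x w', K.Reachable (G.tail d) x ∧ w' ∈ S ∧ G.head d ≠ w' ∧ adj x w' := by
    by_contra! hcon
    have hd0 := hzero d hdS
    have hnot : ∀ z : Fin 2 → ℤ, (G.tail d, z) ∉
        ({(G.head d, G.transl d)} : Finset (V × (Fin 2 → ℤ))) := fun z hz => by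
      simp only [Finset.mem_singleton, Prod.mk.injEq] at hz
      exact hG.tail_ne_head hd0 hz.1
    have key := hG.induct {(G.head d, G.transl d)} (by simp)
      (fun x => K.Reachable (G.tail d) x.1 ∧ ∀ i, p x.1 i + (x.2 i : ℝ) = p (G.tail d) i)
      (x₀ := (G.tail d, 0)) (hnot 0) ⟨.refl _, by simp⟩ (by
        rintro ⟨v, z⟩ e ⟨hv, hpos⟩ he hS'
        simp only at he hpos hv hS' ⊢
        subst he
        have he0 := hzero e (hreach _ hv)
        have hpos' : ∀ i, p (G.head e) i + ((z + G.transl e) i : ℤ) = p (G.tail d) i := by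
          intro i
          have h1 := congrFun he0 i
          have h2 := hpos i
          simp only [displ, Pi.add_apply, Pi.sub_apply, Pi.zero_apply, Int.cast_add] at h1 ⊢
          linarith
        refine ⟨?_, hpos'⟩
        by_cases hh : G.head e ∈ S
        · exfalso
          have hw1 : G.head d = G.head e := by
            by_contra hne
            exact hcon _ _ hv hh hne ⟨e, rfl, rfl⟩
          refine hS' ?_
          rw [Finset.mem_singleton]
          refine Prod.ext hw1.symm (funext fun i => ?_)
          have h1 := congrFun hd0 i
          have h2 := hpos' i
          simp only [displ, Pi.add_apply, Pi.sub_apply, Pi.zero_apply] at h1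
          rw [← hw1] at h2
          have : (((z + G.transl e) i : ℤ) : ℝ) = G.transl d i := by linarith
          exact_mod_cast this
        · refine hv.trans (SimpleGraph.Adj.reachable ?_)
          exact ⟨hG.tail_ne_head he0, Or.inl ⟨hreach _ hv, hh, e, rfl, rfl⟩⟩)
    have := (key (G.tail d, fun _ => 1) (hnot _)).2 0
    simp at this
  obtain ⟨q, hq⟩ := hx.exists_isPath
  refine ⟨q.support, q.support_ne_nil, hq.support_nodup, fun y hy => ?_, ?_,
    G.head d, hw, w', hw', hne, ?_, ?_⟩
  · exact hreach y (q.takeUntil y hy).reachable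
  · exact q.isChain_adj_support.imp fun a b h => (hKadj a b h).2.2
  · rw [SimpleGraph.Walk.head_support]
    exact ⟨d, rfl, rfl⟩
  · rw [SimpleGraph.Walk.getLast_support]
    exact hxw

/-- The ties of the component of the displacement along `a` are broken by the component along `b`
first, and by the differences of a function without local extrema then. -/
theorem IsEquilibrium.isTieBroken {p : V → Fin 2 → ℝ} (hp : G.IsEquilibrium p)
    (hG : G.EssentiallyThreeConnected) {a b : Fin 2 → ℝ}
    (hab : ∀ x, a ⬝ᵥ x = 0 → b ⬝ᵥ x = 0 → x = 0) {φ : V → ℝ}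
    (hφ : NoLocalExtremum (fun x y => ∃ d, G.tail d = x ∧ G.head d = y)
      {v | ∃ d, G.tail d = v ∧ G.displ p d ≠ 0} Finset.univ φ) :
    G.IsTieBroken (fun d => a ⬝ᵥ G.displ p d) fun d =>
      if b ⬝ᵥ G.displ p d = 0 then φ (G.head d) - φ (G.tail d) else b ⬝ᵥ G.displ p d := by
  have hne : ∀ d, a ⬝ᵥ G.displ p d = 0 →
      (if b ⬝ᵥ G.displ p d = 0 then φ (G.head d) - φ (G.tail d) else b ⬝ᵥ G.displ p d) ≠ 0 := by
    intro d hd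
    split_ifs with h
    · rw [sub_ne_zero]
      intro heq
      exact hG.tail_ne_head (hab _ hd h) (hφ.1 (by simp) (by simp) heq).symm
    · exact h
  -- Common part of the arguments for vertices and for faces.
  have aux : ∀ s : Set D, ∑ d with d ∈ s, G.displ p d = 0 →
      ((∀ d ∈ s, G.displ p d = 0) →
        TakesBothSigns (fun d => φ (G.head d) - φ (G.tail d)) s) →
      TakesBothSigns (fun d => a ⬝ᵥ G.displ p d) s ∨ (∀ d ∈ s, a ⬝ᵥ G.displ p d = 0) ∧
        TakesBothSigns (fun d => if b ⬝ᵥ G.displ p d = 0 then φ (G.head d) - φ (G.tail d)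
          else b ⬝ᵥ G.displ p d) s := by
    intro s hs hs0
    have hsum : ∀ x : Fin 2 → ℝ, ∑ d with d ∈ s, x ⬝ᵥ G.displ p d = 0 := fun x => by
      rw [← dotProduct_sum, hs, dotProduct_zero]
    by_cases h : ∀ d ∈ s, a ⬝ᵥ G.displ p d = 0
    · refine Or.inr ⟨h, ?_⟩
      by_cases hb : ∀ d ∈ s, b ⬝ᵥ G.displ p d = 0
      · obtain ⟨⟨x, hx, hx'⟩, y, hy, hy'⟩ := hs0 fun d hd => hab _ (h d hd) (hb d hd)
        exact ⟨⟨x, hx, by simpa [hb x hx] using hx'⟩, y, hy, by simpa [hb y hy] using hy'⟩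
      · push Not at hb
        obtain ⟨z, hz, hz'⟩ := hb
        obtain ⟨⟨x, hx, hx'⟩, y, hy, hy'⟩ := takesBothSigns_of_sum_eq_zero (hsum b) hz hz'
        beta_reduce at hx' hy'
        exact ⟨⟨x, hx, by beta_reduce; rwa [if_neg hx'.ne']⟩, y, hy,
          by beta_reduce; rwa [if_neg hy'.ne]⟩
    · push Not at h
      obtain ⟨z, hz, hz'⟩ := h
      exact Or.inl (takesBothSigns_of_sum_eq_zero (hsum a) hz hz')
  refine ⟨fun d => ?_, fun d => ?_, hne, fun v => ?_, fun f => ?_⟩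
  · rw [displ_rev, dotProduct_neg]
  · have : G.tail (G.rev d) = G.head d := rfl
    simp only [displ_rev, dotProduct_neg, neg_eq_zero, head_rev, this]
    split_ifs <;> ring
  · refine aux {d | G.tail d = v} (hp v) fun h0 => ?_
    obtain ⟨⟨x, _, ⟨d, hd, rfl⟩, h1⟩, y, _, ⟨e, he, rfl⟩, h2⟩ := hφ.2 v (by simp)
      (by rintro ⟨d, hd, hd'⟩; exact hd' (h0 d hd))
    exact ⟨⟨d, hd, by beta_reduce; rw [hd]; linarith⟩, e, he,
      by beta_reduce; rw [he]; linarith⟩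
  · refine aux {d | G.faceOf d = f} (G.sum_face_displ p f) fun h0 => ?_
    obtain ⟨d, hd⟩ := G.faceOf_surjective f
    refine takesBothSigns_of_sum_eq_zero (G.sum_face_head_sub_tail f φ) (x := d) hd ?_
    have := hne d (by rw [h0 d hd, dotProduct_zero])
    rwa [if_pos (by rw [h0 d hd, dotProduct_zero])] at this

/-! ### Darts of displacement zero -/

/-- In a 3-connected drawing in equilibrium no edge is contracted to a point. -/
theorem EssentiallyThreeConnected.displ_ne_zero (hG : G.EssentiallyThreeConnected)
    {p : V → Fin 2 → ℝ} (hp : G.IsEquilibrium p) (c : D) : G.displ p c ≠ 0 := by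
  intro hc
  obtain ⟨φ, hφ⟩ := hG.exists_noLocalExtremum c p
  by_cases hall : ∀ e, G.tail e = G.tail c → G.displ p e = 0
  · obtain ⟨e, he, he'⟩ := hG.exists_dart_dotProduct_ne_zero p (a := ![1, 0]) (by simp)
      (hp.isTieBroken hG (b := ![0, 1]) (fun x h1 h2 => by
        ext i; fin_cases i
        · simpa [dotProduct] using h1
        · simpa [dotProduct] using h2) hφ) c
    exact he' (by rw [hall e he, dotProduct_zero])
  · push Not at hall
    obtain ⟨e, he, he'⟩ := hall
    obtain ⟨d, hd, hd0, hd1⟩ := exists_change_of_sameCycle (P := fun x => G.displ p x = 0)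
      ((G.sameCycle_rot_iff c e).2 he.symm) hc he'
    have hdc : G.tail d = G.tail c := ((G.sameCycle_rot_iff c d).1 hd).symm
    -- The form perpendicular to the first nonzero displacement that follows a zero displacement
    -- vanishes on both darts; its ties may be broken by `b` or by `-b`.
    set b := G.displ p (G.rot d) with hb
    have hb0 : 0 < b 0 * b 0 + b 1 * b 1 := by
      rcases (not_and_or.1 fun h : b 0 = 0 ∧ b 1 = 0 => hd1 (by
        ext i; fin_cases i
        · exact h.1
        · exact h.2)) with h | h
      · have := mul_self_pos.2 h
        have := mul_self_nonneg (b 1)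
        linarith
      · have := mul_self_pos.2 h
        have := mul_self_nonneg (b 0)
        linarith
    have hindep : ∀ x, ![-b 1, b 0] ⬝ᵥ x = 0 → b ⬝ᵥ x = 0 → x = 0 := by
      intro x h1 h2
      simp only [dotProduct, Fin.sum_univ_two, Matrix.cons_val_zero, Matrix.cons_val_one] at h1 h2
      have e0 : (b 0 * b 0 + b 1 * b 1) * x 0 = 0 := by linear_combination b 0 * h2 - b 1 * h1
      have e1 : (b 0 * b 0 + b 1 * b 1) * x 1 = 0 := by linear_combination b 1 * h2 + b 0 * h1
      ext i; fin_cases i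
      · exact (mul_eq_zero.1 e0).resolve_left hb0.ne'
      · exact (mul_eq_zero.1 e1).resolve_left hb0.ne'
    have ha : ![-b 1, b 0] ≠ 0 := by
      intro h
      have h0 := congrFun h 0
      have h1 := congrFun h 1
      simp at h0 h1
      simp [h0, h1] at hb0
    have t1 := hp.isTieBroken hG hindep hφ
    have t2 := hp.isTieBroken hG (a := ![-b 1, b 0]) (b := -b)
      (fun x h1 h2 => hindep x h1 (by rwa [neg_dotProduct, neg_eq_zero] at h2)) hφ
    obtain ⟨x, hx, hx'⟩ := hG.exists_dart_dotProduct_ne_zero p ha t1 d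
    have z0 : ![-b 1, b 0] ⬝ᵥ G.displ p d = 0 := by rw [hd0, dotProduct_zero]
    have z1 : ![-b 1, b 0] ⬝ᵥ G.displ p (G.rot d) = 0 := by
      rw [← hb]; simp [dotProduct]; ring
    have hbb : 0 < b ⬝ᵥ b := by simpa [dotProduct] using hb0
    have s1 := t1.pos_iff_pos_rot G.euler hx hx' z0 z1
    have s2 := t2.pos_iff_pos_rot G.euler hx hx' z0 z1
    simp only [hd0, dotProduct_zero, if_true, ← hb, neg_dotProduct, neg_eq_zero, hbb.ne',
      if_false] at s1 s2
    have := s2.1 (s1.2 hbb)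
    linarith

end TorusGraph

end

theorem mainTheorem10 {V D : Type*} [Fintype V] [Fintype D] [DecidableEq D]
    (G : TorusGraph V D) (hG : G.EssentiallyThreeConnected) (d : D) (w : D → ℝ)
    (hw : ∀ e, w e = if e = d then 2 else 1) :
    (∀ e, 0 < w e) ∧ ¬ G.Realizable w := by
  classical
  refine ⟨fun e => by rw [hw]; split_ifs <;> norm_num, ?_⟩
  rintro ⟨p, hp⟩
  have hvert : ∀ v, ∑ e with G.tail e = v, w e • G.displ p e = 0 := by
    intro v
    rw [← hp v, finsum_mem_eq_finite_toFinset_sum _ (Set.toFinite _)]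
    refine Finset.sum_congr (by ext e; simp) fun e he => ?_
    rw [TorusGraph.displ, show G.tail e = v by simpa using he]
  have hwe : ∀ e, w e • G.displ p e = G.displ p e + if e = d then G.displ p d else 0 := by
    intro e
    rw [hw]
    split_ifs with h
    · rw [h, two_smul]
    · rw [one_smul, add_zero]
  -- The sum of all equations: opposite darts of weight `1` cancel, and one copy of `d` remains.
  have hanti : ∑ e, G.displ p e = 0 := by
    have h : ∑ e, G.displ p e = -∑ e, G.displ p e := by
      rw [← Finset.sum_neg_distrib]
      refine Finset.sum_equiv G.rev (by simp) fun e _ => ?_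
      rw [TorusGraph.displ_rev, neg_neg]
    exact self_eq_neg.1 h
  have hd : G.displ p d = 0 := by
    have h : ∑ e, w e • G.displ p e = 0 := by
      rw [← Finset.sum_fiberwise _ G.tail]
      exact Finset.sum_eq_zero fun v _ => hvert v
    simpa only [hwe, Finset.sum_add_distrib, hanti, Finset.sum_ite_eq', Finset.mem_univ,
      if_true, zero_add] using h
  refine hG.displ_ne_zero (fun v => ?_) d hd
  have h := hvert v
  simp only [hwe, hd, ite_self, add_zero] at h
  convert h
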